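/- **Conventions.** Let $P$ be a finite bounded graded poset of rank $n$, with least element $\hat 0$, greatest element $\hat 1$ and rank function $\operatorname{rk}$; write $s\lessdot t$ if $t$ covers $s$. An edge labeling $\lambda$ assigns to every cover relation $s\lessdot t$ an element $\lambda(s,t)$ of a totally ordered set. It is an *EL-labeling* if for all $s\le t$ the interval $[s,t]$ has a unique maximal chain with weakly increasing labels (read from $s$ to $t$), and the label word of this chain is lexicographically minimal among those of all maximal chains of $[s,t]$. For $s\in P$ let $\lambda_1<\cdots<\lambda_\ell$ be the distinct labels of the cover relations above $s$. For $s\lessdot t$ let $\mathrm{Ind}(s,t)$ be the index $i$ with $\lambda(s,t)=\lambda_i$; let $\omega_s(i)$ be the number of $t\gtrdot s$ with $\mathrm{Ind}(s,t)=i$; and let $\mathrm{des}_s(t)$ be the number of distinct labels of cover relations above $t$ that are strictly smaller than $\lambda(s,t)$. The poset $P$ is *UMEL-shellable* if it admits an EL-labeling such that 1. $\omega_s(i)=\omega_{s'}(i)$ for all $i\ge 1$ whenever $\operatorname{rk}s=\operatorname{rk}s'$; 2. $\mathrm{des}_s(t)=\mathrm{des}_{s'}(t')$ whenever $\operatorname{rk}s=\operatorname{rk}s'$,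 $s\lessdot t$, $s'\lessdot t'$ and $\mathrm{Ind}(s,t)=\mathrm{Ind}(s',t')$; 3. $\mathrm{des}_s(t)\le \mathrm{des}_s(t')$ whenever $s\lessdot t$, $s\lessdot t'$ and $\mathrm{Ind}(s,t)\le \mathrm{Ind}(s,t')$. The *$h$-polynomial* of $P$ is the $h$-polynomial of its order complex, $h_P(y)=\sum_{i=0}^{d} f_i\,y^i(1-y)^{d-i}$, where $f_i$ is the number of chains of $P$ with $i$ elements and $d=n+1$. For $s<t$ let $\overline\chi_{s,t}(x)=\frac{1}{x-1}\sum_{s\le u\le t}\mu(s,u)\,x^{\operatorname{rk}t-\operatorname{rk}u}$ be the reduced characteristic polynomial of $[s,t]$, where $\mu$ is the Möbius function. The *Chow polynomials* $\underline{\mathrm H}_{s,\hat 1}(x)$ of the intervals $[s,\hat 1]$ are defined recursively by $\underline{\mathrm H}_{\hat 1,\hat 1}=1$ and $$\underline{\mathrm H}_{s,\hat 1}(x)=\sum_{s<u\le \hat 1}\overline\chi_{s,u}(x)\,\underline{\mathrm H}_{u,\hat 1}(x)\qquad(s<\hat 1).$$ The Chow polynomial of $P$ is $\underline{\mathrm H}_P=\underline{\mathrm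 H}_{\hat 0,\hat 1}$, and its *augmented Chow polynomial* is $\mathrm H_P(x)=\sum_{s\in P}x^{\operatorname{rk}s}\,\underline{\mathrm H}_{s,\hat 1}(x)$. A polynomial is *real-rooted* if all its complex roots are real. **Corollary.** Let $P$ be a UMEL-shellable poset, and let $P^*$ be its dual, obtained by reversing the order. Then the $h$-polynomial $h_{P^*}$, the Chow polynomial $\underline{\mathrm H}_{P^*}$ and the augmented Chow polynomial $\mathrm H_{P^*}$ of $P^*$ are real-rooted. -/

import Mathlib

open Polynomial

universe u v

namespace UMEL

section Posets

/-- The rank of an element: the maximal length of a strict chain ending at it. -/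
noncomputable def rk {P : Type*} [PartialOrder P] (s : P) : ℕ :=
  (Order.height s).toNat

/-- A finite bounded poset is graded if the rank goes up by exactly one along every cover
relation; equivalently, all its maximal chains have the same length. -/
def IsGraded (P : Type*) [PartialOrder P] : Prop :=
  ∀ s t : P, s ⋖ t → rk t = rk s + 1

/-- `l` lists, in increasing order, the elements of a saturated chain
`s = u₀ ⋖ u₁ ⋖ ⋯ ⋖ u_k = t`, that is, of a maximal chain of the interval `[s, t]`. -/
def IsSaturatedChain {P : Type*} [PartialOrder P] (s t : P) (l : List P) : Prop :=
  l.IsChain (· ⋖ ·) ∧ l.head? = some s ∧ l.getLast? = some t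

end Posets

section EdgeLabelings

/-!
An edge labeling of `P` with labels in `Λ` is given as a function `lab : P → P → Λ`;
only the values `lab s t` with `s ⋖ t` are ever used.
-/

/-- The word of labels `lab u₀ u₁, lab u₁ u₂, …, lab u_{k-1} u_k` of the chain
`[u₀, u₁, …, u_k]`. -/
def chainLabels {P Λ : Type*} (lab : P → P → Λ) : List P → List Λ
  | [] => []
  | [_] => []
  | a :: b :: l => lab a b :: chainLabels lab (b :: l)

/-- Edge-lexicographical labelings: every interval `[s, t]` has exactly one maximal chain with
weakly increasing labels, and its word of labels is lexicographically minimal among those of the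
maximal chains of `[s, t]`. -/
def IsELLabeling {P Λ : Type*} [PartialOrder P] [LinearOrder Λ] (lab : P → P → Λ) : Prop :=
  ∀ s t : P, s ≤ t → ∃ l : List P,
    IsSaturatedChain s t l ∧
    (chainLabels lab l).IsChain (· ≤ ·) ∧
    (∀ l' : List P, IsSaturatedChain s t l' → (chainLabels lab l').IsChain (· ≤ ·) → l' = l) ∧
    (∀ l' : List P, IsSaturatedChain s t l' → chainLabels lab l ≤ chainLabels lab l')

open Classical in
/-- The set of labels of the covering relations above `s`. -/
noncomputable def labelsAbove {P Λ : Type*} [PartialOrder P] [Fintype P]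
    (lab : P → P → Λ) (s : P) : Finset Λ :=
  (Finset.univ.filter fun t : P => s ⋖ t).image (lab s)

open Classical in
/-- `Ind(s, t)`: the position of the label of `s ⋖ t`, counted from `1`, in the increasing
enumeration `λ₁ < ⋯ < λ_ℓ` of the labels above `s`. -/
noncomputable def ind {P Λ : Type*} [PartialOrder P] [Fintype P] [LinearOrder Λ]
    (lab : P → P → Λ) (s t : P) : ℕ :=
  ((labelsAbove lab s).filter fun m => m ≤ lab s t).card

open Classical in
/-- The width above `s` at index `i`: the number of covers of `s` with label `λ_i`. -/
noncomputable def width {P Λ : Type*} [PartialOrder P] [Fintype P] [LinearOrder Λ]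
    (lab : P → P → Λ) (s : P) (i : ℕ) : ℕ :=
  (Finset.univ.filter fun t : P => s ⋖ t ∧ ind lab s t = i).card

open Classical in
/-- `des_s(t)`: the number of distinct labels above `t` that are smaller than the label of
`s ⋖ t`. -/
noncomputable def desCount {P Λ : Type*} [PartialOrder P] [Fintype P] [LinearOrder Λ]
    (lab : P → P → Λ) (s t : P) : ℕ :=
  ((labelsAbove lab t).filter fun m => m < lab s t).card

/-- Rank-uniformity of a labeled poset: uniform widths and uniform descents. -/
def IsRankUniform {P Λ : Type*} [PartialOrder P] [Fintype P] [LinearOrder Λ]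
    (lab : P → P → Λ) : Prop :=
  (∀ s s' : P, rk s = rk s' → ∀ i : ℕ, 1 ≤ i → width lab s i = width lab s' i) ∧
  (∀ s t s' t' : P, rk s = rk s' → s ⋖ t → s' ⋖ t' → ind lab s t = ind lab s' t' →
    desCount lab s t = desCount lab s' t')

/-- Monotonicity of a (rank-uniform) labeled poset: above each element, the descent count is a
weakly increasing function of the index of the label. -/
def IsMonotonic {P Λ : Type*} [PartialOrder P] [Fintype P] [LinearOrder Λ]
    (lab : P → P → Λ) : Prop :=
  ∀ s t t' : P, s ⋖ t → s ⋖ t' → ind lab s t ≤ ind lab s t' →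
    desCount lab s t ≤ desCount lab s t'

/-- UMEL-shellable posets: finite bounded graded posets that admit, with labels in some totally
ordered set, an EL-labeling which is rank-uniform and monotonic. -/
def IsUMELShellable (P : Type u) [PartialOrder P] [BoundedOrder P] [Fintype P] : Prop :=
  IsGraded P ∧ ∃ (Λ : Type v) (_ : LinearOrder Λ) (lab : P → P → Λ),
    IsELLabeling lab ∧ IsRankUniform lab ∧ IsMonotonic lab

end EdgeLabelings

section OrderComplex

open Classical in
/-- The faces of the order complex `Δ(P)`: the chains of `P`, including the empty chain. -/
noncomputable def orderComplexFaces (P : Type*) [PartialOrder P] [Fintype P] :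
    Finset (Finset P) :=
  Finset.univ.filter fun c : Finset P => IsChain (· ≤ ·) (c : Set P)

/-- The `h`-polynomial `∑ᵢ fᵢ yⁱ (1 - y)^(d - i)` of the finite simplicial complex of dimension
`d - 1` with the given faces, where `fᵢ` is the number of faces with `i` elements. -/
noncomputable def hPolyOfFaces {V : Type*} (F : Finset (Finset V)) : ℤ[X] :=
  ∑ i ∈ Finset.range (F.sup Finset.card + 1),
    C (((F.filter fun c => c.card = i).card : ℕ) : ℤ) * X ^ i *
      (1 - X) ^ (F.sup Finset.card - i)

/-- The `h`-polynomial of the order complex of `P`. -/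
noncomputable def hPoly (P : Type*) [PartialOrder P] [Fintype P] : ℤ[X] :=
  hPolyOfFaces (orderComplexFaces P)

end OrderComplex

section Chow

variable {P : Type*} [PartialOrder P] [LocallyFiniteOrder P] [DecidableEq P]

/-- The characteristic polynomial of the interval `[s, t]` of a graded poset:
`∑_{s ≤ u ≤ t} μ(s, u) x^(rk t - rk u)`. -/
noncomputable def charPoly (s t : P) : ℤ[X] :=
  ∑ u ∈ Finset.Icc s t, C (IncidenceAlgebra.mu ℤ s u) * X ^ (rk t - rk u)

/-- The reduced characteristic polynomial of `[s, t]` for `s < t`: the (exact) quotient of the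
characteristic polynomial by `x - 1`. -/
noncomputable def redCharPoly (s t : P) : ℤ[X] :=
  charPoly s t /ₘ (X - 1)

/-- The Chow polynomial of the interval `[s, ⊤]`: it is `1` if `s = ⊤`, and otherwise
`∑_{s < u ≤ ⊤}` of the reduced characteristic polynomial of `[s, u]` times the Chow polynomial of
`[u, ⊤]`. -/
noncomputable def chowAbove [OrderTop P] (s : P) : ℤ[X] :=
  if s = ⊤ then 1
  else ∑ u ∈ (Finset.Ioc s ⊤).attach, redCharPoly s u.1 * chowAbove u.1
termination_by (Finset.Ioc s ⊤).card
decreasing_by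
  apply Finset.card_lt_card
  have h := Finset.mem_Ioc.mp u.2
  refine Finset.ssubset_iff_of_subset (fun x hx => ?_) |>.mpr ⟨u.1, u.2, by simp⟩
  rw [Finset.mem_Ioc] at hx ⊢
  exact ⟨h.1.trans hx.1, hx.2⟩

theorem chowAbove_eq [OrderTop P] (s : P) :
    chowAbove s = if s = ⊤ then 1
      else ∑ u ∈ Finset.Ioc s ⊤, redCharPoly s u * chowAbove u := by
  rw [chowAbove, Finset.sum_attach (Finset.Ioc s ⊤) fun u => redCharPoly s u * chowAbove u]

variable (P) [BoundedOrder P]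

/-- The Chow polynomial of a finite bounded graded poset. -/
noncomputable def chowPoly : ℤ[X] :=
  chowAbove (⊥ : P)

/-- The augmented Chow polynomial `∑_s x^(rk s) H_{[s, ⊤]}(x)` of a finite bounded graded poset,
where `H` is the Chow polynomial. -/
noncomputable def augChowPoly : ℤ[X] :=
  ∑ s ∈ Finset.Icc (⊥ : P) ⊤, X ^ rk s * chowAbove s

end Chow

/-- A polynomial is real-rooted if all its complex roots are real. -/
def RealRooted (p : ℤ[X]) : Prop :=
  ∀ z : ℂ, aeval z p = 0 → z.im = 0

end UMEL

/-!
Instead of interlacing roots one compares values at a single nonreal point: `f` interlaces `g` with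
respect to `v` if `g * conj f` lies in the convex cone spanned by `1` and `v`. This relation has the
closure properties of interlacing polynomials with `v` as the variable, and if `v` does not lie on
the closed negative real axis, a sum of values all of which are interlaced by one of them that is
nonzero does not vanish.

Choosing in each interval `[s, u]` the increasing maximal chain turns sums over `u > s` into sums
over saturated chains starting at `s`, in which every descent of the labels has weight `v` relative
to an ascent. Rank uniformity and monotonicity make the sums over the covers `t` of `s`, ordered by
the labels, interlace successively: this follows by descending induction on `s`, since the number of
descents after `s ⋖ t` grows with the label. The cover with the least label admits no descent, so
that its sum is nonzero by induction, and hence so is the total.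

For the `h`-polynomial at `y`, the chain sums are of this form with `v = y`. For the two Chow
polynomials of the dual at `z`, Möbius inversion yields a recursion with coefficients
`(z ^ k - z) / (z - 1)`, where `k` is a rank difference; its chain sums have `v = z / (1 + z) ^ 2`
and only involve chains without two consecutive descents.
-/

namespace UMEL

open scoped ComplexConjugate NNReal

section Interlacing

/-- Interlacing of the values of two polynomials at a fixed point: `f` interlaces `g` with respect
to `v` if `g * conj f` lies in the convex cone spanned by `1` and `v`. -/
def Interlaces (v f g : ℂ) : Prop :=
  g * conj f ∈ Submodule.span ℝ≥0 {1, v}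

namespace Interlaces

variable {v f f₁ f₂ g g₁ g₂ : ℂ}

theorem iff_exists :
    Interlaces v f g ↔ ∃ a b : ℝ≥0, (a : ℂ) + b * v = g * conj f := by
  simp [Interlaces, Submodule.mem_span_pair, NNReal.smul_def]

theorem refl (v f : ℂ) : Interlaces v f f :=
  iff_exists.mpr ⟨‖f‖₊ ^ 2, 0, by simp [Complex.mul_conj, Complex.normSq_eq_norm_sq]⟩

theorem zero_left (v g : ℂ) : Interlaces v 0 g := by simp [Interlaces]

theorem zero_right (v f : ℂ) : Interlaces v f 0 := by simp [Interlaces]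

theorem add_right (h₁ : Interlaces v f g₁) (h₂ : Interlaces v f g₂) :
    Interlaces v f (g₁ + g₂) := by
  simpa only [Interlaces, add_mul] using add_mem h₁ h₂

theorem add_left (h₁ : Interlaces v f₁ g) (h₂ : Interlaces v f₂ g) :
    Interlaces v (f₁ + f₂) g := by
  simpa only [Interlaces, map_add, mul_add] using add_mem h₁ h₂

theorem sum_sum {ι κ : Type*} {s : Finset ι} {t : Finset κ} {f : ι → ℂ} {g : κ → ℂ}
    (h : ∀ i ∈ s, ∀ j ∈ t, Interlaces v (f i) (g j)) :
    Interlaces v (∑ i ∈ s, f i) (∑ j ∈ t, g j) := by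
  rw [Interlaces, map_sum, Finset.sum_mul_sum]
  exact sum_mem fun j hj => sum_mem fun i hi => h i hi j hj

theorem mul_mul (κ : ℂ) (h : Interlaces v f g) : Interlaces v (κ * f) (κ * g) := by
  have hκ : κ * g * conj (κ * f) = (‖κ‖₊ ^ 2) • (g * conj f) :=
    calc κ * g * conj (κ * f) = κ * conj κ * (g * conj f) := by rw [map_mul]; ring
      _ = (‖κ‖₊ ^ 2) • (g * conj f) := by rw [Complex.mul_conj']; simp [NNReal.smul_def]
  rw [Interlaces, hκ]
  exact Submodule.smul_mem _ _ h

theorem mul_flip (h : Interlaces v f g) : Interlaces v g (v * f) := by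
  obtain ⟨a, b, hab⟩ := iff_exists.mp h
  refine iff_exists.mpr ⟨b * ‖v‖₊ ^ 2, a, ?_⟩
  calc ((b * ‖v‖₊ ^ 2 : ℝ≥0) : ℂ) + a * v = v * conj ((a : ℂ) + b * v) := by
        have hv : v * conj v = (‖v‖ : ℂ) ^ 2 := Complex.mul_conj' v
        simp only [map_add, map_mul, Complex.conj_ofReal, NNReal.coe_mul, NNReal.coe_pow,
          coe_nnnorm, Complex.ofReal_mul, Complex.ofReal_pow]
        linear_combination (-b : ℂ) * hv
    _ = v * f * conj g := by rw [hab, map_mul, Complex.conj_conj]; ring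

theorem add_ne_zero (hv : v ∈ Complex.slitPlane) (hf : f ≠ 0) (h : Interlaces v f g) :
    f + g ≠ 0 := by
  intro hfg
  obtain ⟨a, b, hab⟩ := iff_exists.mp h
  have hpos : 0 < Complex.normSq f := Complex.normSq_pos.mpr hf
  have hsum : (Complex.normSq f : ℂ) + a + b * v = 0 := by
    rw [Complex.normSq_eq_conj_mul_self]
    linear_combination hab + conj f * hfg
  have hre : Complex.normSq f + a + b * v.re = 0 := by simpa using congrArg Complex.re hsum
  have him : b = 0 ∨ v.im = 0 := by simpa using congrArg Complex.im hsum
  have := a.coe_nonneg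
  rcases hv with hv | hv
  · have := mul_nonneg b.coe_nonneg hv.le
    linarith
  · simp only [him.resolve_right hv, NNReal.coe_zero, zero_mul] at hre
    linarith

theorem sum_ne_zero {ι : Type*} {s : Finset ι} {g : ι → ℂ} (hv : v ∈ Complex.slitPlane)
    {i : ι} (hi : i ∈ s) (hgi : g i ≠ 0) (h : ∀ j ∈ s, Interlaces v (g i) (g j)) :
    ∑ j ∈ s, g j ≠ 0 := by
  classical
  rw [← Finset.add_sum_erase s g hi]
  refine add_ne_zero hv hgi ?_
  simpa using sum_sum (s := {i}) (f := g) fun i' hi' j hj =>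
    Finset.mem_singleton.mp hi' ▸ h j (Finset.mem_of_mem_erase hj)

theorem add_add_mul {a b b' c : ℂ} (hab : Interlaces v a b) (hab' : Interlaces v a b')
    (hbc : Interlaces v b c) (hbb' : Interlaces v b b') (hb'c : Interlaces v b' c) :
    Interlaces v (b' + c + v * a) (c + v * (a + b)) := by
  have hb' : Interlaces v b' (c + v * a + v * b) :=
    (hb'c.add_right hab'.mul_flip).add_right hbb'.mul_flip
  have hca : Interlaces v (c + v * a) (c + v * a + v * b) :=
    (refl v _).add_right (hbc.mul_flip.add_left (hab.mul_mul v))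
  simpa only [add_assoc, mul_add] using hb'.add_left hca

end Interlaces

section Thresholds

variable {ι α M : Type*} [LinearOrder α] [AddCommMonoid M] {U : Finset ι} {k : ι → α} {d d' : α}

theorem sum_threshold_lt_eq_add (h : d ≤ d') (f : ι → M) :
    ∑ i ∈ U with d < k i, f i =
      ∑ i ∈ U with d < k i ∧ k i ≤ d', f i + ∑ i ∈ U with d' < k i, f i := by
  rw [← Finset.sum_filter_add_sum_filter_not _ (fun i => k i ≤ d'), Finset.filter_filter,
    Finset.filter_filter]
  simp only [not_le]
  congr! 3 with i
  exact and_iff_right_of_imp h.trans_lt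

theorem sum_threshold_le_eq_add (h : d ≤ d') (f : ι → M) :
    ∑ i ∈ U with k i ≤ d', f i =
      ∑ i ∈ U with k i ≤ d, f i + ∑ i ∈ U with d < k i ∧ k i ≤ d', f i := by
  rw [← Finset.sum_filter_add_sum_filter_not _ (fun i => k i ≤ d), Finset.filter_filter,
    Finset.filter_filter]
  simp only [not_le, and_comm (b := d < _)]
  congr! 3 with i
  exact and_iff_right_of_imp fun hi => hi.trans h

end Thresholds

/-- Two families `g`, `e` of values, indexed by a finite set `U` and ordered by `k`, that are each
pairwise interlacing along `k` and whose `e` part interlaces every difference `g j - e j`. -/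
structure IsInterlacingPair {ι α : Type*} [LinearOrder α] (v : ℂ) (U : Finset ι) (k : ι → α)
    (g e : ι → ℂ) : Prop where
  fst : ∀ i ∈ U, ∀ j ∈ U, k i ≤ k j → Interlaces v (g i) (g j)
  snd : ∀ i ∈ U, ∀ j ∈ U, k i ≤ k j → Interlaces v (e i) (e j)
  snd_sub : ∀ i ∈ U, ∀ j ∈ U, Interlaces v (e i) (g j - e j)

namespace IsInterlacingPair

variable {ι α : Type*} [LinearOrder α] {v : ℂ} {U : Finset ι} {k : ι → α} {g e : ι → ℂ}
  {d d' : α}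

theorem snd_fst (h : IsInterlacingPair v U k g e) {i j : ι} (hi : i ∈ U) (hj : j ∈ U)
    (hij : k i ≤ k j) : Interlaces v (e i) (g j) := by
  simpa using (h.snd i hi j hj hij).add_right (h.snd_sub i hi j hj)

theorem sum_snd_sum_fst_of_subset (h : IsInterlacingPair v U k g e) {S : Finset ι} (hS : S ⊆ U) :
    Interlaces v (∑ i ∈ S, e i) (∑ i ∈ S, g i) := by
  have hsub : Interlaces v (∑ i ∈ S, e i) (∑ i ∈ S, (g i - e i)) :=
    .sum_sum fun i hi j hj => h.snd_sub i (hS hi) j (hS hj)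
  simpa using (Interlaces.refl v (∑ i ∈ S, e i)).add_right hsub

theorem sum_fst (h : IsInterlacingPair v U k g e) (hd : d ≤ d') :
    Interlaces v (∑ i ∈ U with d < k i, g i) (∑ i ∈ U with d' < k i, g i) := by
  rw [sum_threshold_lt_eq_add hd]
  refine .add_left (.sum_sum ?_) (.refl _ _)
  simp only [Finset.mem_filter]
  exact fun i hi j hj => h.fst i hi.1 j hj.1 (hi.2.2.trans hj.2.le)

theorem sum_snd_sum_fst (h : IsInterlacingPair v U k g e) (d d' : α) :
    Interlaces v (∑ i ∈ U with k i ≤ d', e i) (∑ i ∈ U with d < k i, g i) := by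
  have hdisj : ∀ {p q : α}, p ≤ q →
      Interlaces v (∑ i ∈ U with k i ≤ p, e i) (∑ i ∈ U with q < k i, g i) := fun hpq =>
    .sum_sum fun i hi j hj => by
      rw [Finset.mem_filter] at hi hj
      exact h.snd_fst hi.1 hj.1 (hi.2.trans (hpq.trans hj.2.le))
  rcases le_total d' d with hd | hd
  · exact hdisj hd
  rw [sum_threshold_lt_eq_add hd, sum_threshold_le_eq_add hd]
  refine ((Interlaces.sum_sum ?_).add_left
    (h.sum_snd_sum_fst_of_subset (Finset.filter_subset _ _))).add_right
      ((hdisj hd).add_left (.sum_sum ?_)) <;> simp only [Finset.mem_filter] <;> intro i hi j hj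
  · exact h.snd_fst hi.1 hj.1 (hi.2.trans hj.2.1.le)
  · exact h.snd_fst hi.1 hj.1 (hi.2.2.trans hj.2.le)

theorem sum_fst_add_mul_sum_snd (h : IsInterlacingPair v U k g e) (hd : d ≤ d') :
    Interlaces v (∑ i ∈ U with d < k i, g i + v * ∑ i ∈ U with k i ≤ d, e i)
      (∑ i ∈ U with d' < k i, g i + v * ∑ i ∈ U with k i ≤ d', e i) := by
  rw [sum_threshold_lt_eq_add hd, sum_threshold_le_eq_add hd]
  refine .add_add_mul ?_ ?_ ?_ (h.sum_snd_sum_fst_of_subset (Finset.filter_subset _ _)) ?_ <;>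
    refine .sum_sum ?_ <;> simp only [Finset.mem_filter] <;> intro i hi j hj
  · exact h.snd i hi.1 j hj.1 (hi.2.trans hj.2.1.le)
  · exact h.snd_fst hi.1 hj.1 (hi.2.trans hj.2.1.le)
  · exact h.snd_fst hi.1 hj.1 (hi.2.2.trans hj.2.le)
  · exact h.fst i hi.1 j hj.1 (hi.2.2.trans hj.2.le)

end IsInterlacingPair

end Interlacing

section Labels

variable {P : Type u} [PartialOrder P] [Fintype P]

open Classical in
/-- The elements covering `s`. -/
noncomputable def coversAbove (s : P) : Finset P := {t | s ⋖ t}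

theorem mem_coversAbove {s t : P} : t ∈ coversAbove s ↔ s ⋖ t := by simp [coversAbove]

variable {Λ : Type v} {lab : P → P → Λ} {s t t' u : P}

theorem lab_mem_labelsAbove (h : s ⋖ t) : lab s t ∈ labelsAbove lab s := by
  classical
  exact Finset.mem_image_of_mem _ (mem_coversAbove.mpr h)

variable [LinearOrder Λ]

theorem one_le_ind (h : s ⋖ t) : 1 ≤ ind lab s t :=
  Finset.card_pos.mpr ⟨lab s t, Finset.mem_filter.mpr ⟨lab_mem_labelsAbove h, le_rfl⟩⟩

theorem ind_le_ind (h : lab s t ≤ lab s t') : ind lab s t ≤ ind lab s t' :=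
  Finset.card_le_card (Finset.monotone_filter_right _ fun _ _ hm => le_trans hm h)

theorem desCount_lt_ind_iff (h : t ⋖ u) : desCount lab s t < ind lab t u ↔ lab s t ≤ lab t u := by
  constructor
  · contrapose!
    exact fun hlt => Finset.card_le_card
      (Finset.monotone_filter_right _ fun _ _ hm => lt_of_le_of_lt hm hlt)
  · intro hle
    refine Finset.card_lt_card (Finset.ssubset_iff_of_subset
      (Finset.monotone_filter_right _ fun _ _ hm => (lt_of_lt_of_le hm hle).le) |>.mpr
        ⟨lab t u, ?_, ?_⟩)
    · exact Finset.mem_filter.mpr ⟨lab_mem_labelsAbove h, le_rfl⟩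
    · exact fun hmem => hle.not_gt (Finset.mem_filter.mp hmem).2

theorem ind_le_desCount_iff (h : t ⋖ u) : ind lab t u ≤ desCount lab s t ↔ lab t u < lab s t := by
  rw [← not_lt, desCount_lt_ind_iff h, not_le]

theorem width_zero (lab : P → P → Λ) (s : P) : width lab s 0 = 0 := by
  classical
  exact Finset.card_eq_zero.mpr <| Finset.filter_eq_empty_iff.mpr fun t _ h =>
    (one_le_ind (lab := lab) h.1).not_gt (by omega)

theorem IsRankUniform.width_eq (hU : IsRankUniform lab) (h : rk t = rk t') (i : ℕ) :
    width lab t i = width lab t' i := by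
  rcases Nat.eq_zero_or_pos i with rfl | hi
  · rw [width_zero, width_zero]
  · exact hU.1 t t' h i hi

theorem width_eq_card (lab : P → P → Λ) (s : P) (i : ℕ) :
    width lab s i = Nat.card {t : coversAbove s // ind lab s t = i} := by
  rw [width, ← Finset.filter_filter]
  change ((coversAbove s).filter _).card = _
  rw [← Nat.card_eq_finsetCard]
  exact Nat.card_congr ((Equiv.subtypeSubtypeEquivSubtypeInter (· ∈ coversAbove s) _).trans
    (Equiv.subtypeEquivRight fun t => Finset.mem_filter.symm)).symm

theorem IsRankUniform.exists_coversAbove_equiv (hU : IsRankUniform lab) (h : rk t = rk t') :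
    ∃ e : coversAbove t ≃ coversAbove t', ∀ u, ind lab t' (e u) = ind lab t u := by
  have he (i : ℕ) : Nonempty
      ({u : coversAbove t // ind lab t u = i} ≃ {u : coversAbove t' // ind lab t' u = i}) :=
    Finite.card_eq.mp (by rw [← width_eq_card, ← width_eq_card, hU.width_eq h])
  exact ⟨Equiv.ofFiberEquiv fun i => (he i).some, fun u =>
    Equiv.ofFiberEquiv_map (g := fun u : coversAbove t' => ind lab t' u) _ u⟩

theorem IsRankUniform.sum_coversAbove_eq {M : Type*} [AddCommMonoid M] (hU : IsRankUniform lab)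
    (h : rk t = rk t') (p : ℕ → Prop) [DecidablePred p] {f f' : P → M}
    (hf : ∀ u u', t ⋖ u → t' ⋖ u' → ind lab t u = ind lab t' u' → f u = f' u') :
    ∑ u ∈ coversAbove t with p (ind lab t u), f u =
      ∑ u ∈ coversAbove t' with p (ind lab t' u), f' u := by
  obtain ⟨e, he⟩ := hU.exists_coversAbove_equiv h
  rw [Finset.sum_filter, Finset.sum_filter, ← Finset.sum_coe_sort (coversAbove t),
    ← Finset.sum_coe_sort (coversAbove t')]
  refine Fintype.sum_equiv e _ _ fun u => ?_
  rw [he, hf u (e u) (mem_coversAbove.mp u.2) (mem_coversAbove.mp (e u).2) (he u).symm]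

section AscentsAndDescents

variable {M : Type*} [AddCommMonoid M]

/-- The sum of `f t u` over the covers `u` of `t` that follow `s ⋖ t` without a descent of the
labels. -/
noncomputable def ascSum (lab : P → P → Λ) (f : P → P → M) (s t : P) : M :=
  ∑ u ∈ coversAbove t with lab s t ≤ lab t u, f t u

/-- The sum of `f t u` over the covers `u` of `t` that follow `s ⋖ t` with a descent of the
labels. -/
noncomputable def desSum (lab : P → P → Λ) (f : P → P → M) (s t : P) : M :=
  ∑ u ∈ coversAbove t with lab t u < lab s t, f t u

theorem ascSum_add_desSum (lab : P → P → Λ) (f : P → P → M) (s t : P) :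
    ascSum lab f s t + desSum lab f s t = ∑ u ∈ coversAbove t, f t u := by
  simpa only [ascSum, desSum, not_le] using
    Finset.sum_filter_add_sum_filter_not (coversAbove t) (fun u => lab s t ≤ lab t u) (f t)

theorem ascSum_top [OrderTop P] (lab : P → P → Λ) (f : P → P → M) (s : P) :
    ascSum lab f s ⊤ = 0 :=
  Finset.sum_eq_zero fun _ hu =>
    absurd (mem_coversAbove.mp (Finset.mem_filter.mp hu).1).lt not_top_lt

theorem ascSum_eq_sum_desCount_lt_ind (lab : P → P → Λ) (f : P → P → M) (s t : P) :
    ascSum lab f s t = ∑ u ∈ coversAbove t with desCount lab s t < ind lab t u, f t u :=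
  Finset.sum_congr (Finset.filter_congr fun _ hu =>
    (desCount_lt_ind_iff (mem_coversAbove.mp hu)).symm) fun _ _ => rfl

theorem desSum_eq_sum_ind_le_desCount (lab : P → P → Λ) (f : P → P → M) (s t : P) :
    desSum lab f s t = ∑ u ∈ coversAbove t with ind lab t u ≤ desCount lab s t, f t u :=
  Finset.sum_congr (Finset.filter_congr fun _ hu =>
    (ind_le_desCount_iff (mem_coversAbove.mp hu)).symm) fun _ _ => rfl

end AscentsAndDescents

end Labels

section Rank

variable {P : Type u} [PartialOrder P] [Finite P] {s : P}

theorem natCast_rk (s : P) : (rk s : ℕ∞) = Order.height s := by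
  have := Fintype.ofFinite P
  have hle : Order.height s ≤ Fintype.card P :=
    Order.height_le_iff'.mpr fun p _ => by exact_mod_cast p.length_lt_card.le
  exact ENat.natCast_toNat (ne_top_of_le_ne_top (ENat.natCast_ne_top _) hle)

theorem rk_le_iff {n : ℕ} : rk s ≤ n ↔ ∀ t < s, rk t < n := by
  simpa only [← natCast_rk, Nat.cast_le, Nat.cast_lt] using
    Order.height_le_coe_iff (x := s) (n := n)

theorem rk_strictMono : StrictMono (rk : P → ℕ) := fun s _ h => rk_le_iff.mp le_rfl s h

variable [OrderTop P]

theorem rk_le_rk_top (s : P) : rk s ≤ rk (⊤ : P) := rk_strictMono.monotone le_top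

theorem eq_top_of_rk_eq (h : rk s = rk (⊤ : P)) : s = ⊤ := by
  by_contra hs
  exact (rk_strictMono (lt_top_iff_ne_top.mpr hs)).ne h

theorem exists_covBy_of_ne_top (h : s ≠ ⊤) : ∃ t, s ⋖ t :=
  (exists_covBy_le_of_lt (lt_top_iff_ne_top.mpr h)).imp fun _ => And.left

theorem IsGraded.rk_toDual_add_rk (hG : IsGraded P) (s : P) :
    rk (OrderDual.toDual s) + rk s = rk (⊤ : P) := by
  induction s using WellFoundedGT.induction with
  | ind s ih =>
    apply le_antisymm
    · have hle : rk (OrderDual.toDual s) ≤ rk (⊤ : P) - rk s := rk_le_iff.mpr fun t hst => by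
        have hlt : rk s < rk (OrderDual.ofDual t) := rk_strictMono hst
        have : rk t + rk (OrderDual.ofDual t) = rk (⊤ : P) := ih _ hst
        omega
      have := rk_le_rk_top s
      omega
    · obtain rfl | hs := eq_or_ne s ⊤
      · exact Nat.le_add_left _ _
      obtain ⟨t, hst⟩ := exists_covBy_of_ne_top hs
      have hlt : rk (OrderDual.toDual t) < rk (OrderDual.toDual s) := rk_strictMono hst.lt
      have := ih t hst.lt
      have := hG s t hst
      omega

end Rank

section SaturatedChains

variable {P : Type u} [PartialOrder P] {s t u : P} {l : List P}

theorem isSaturatedChain_cons_cons :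
    IsSaturatedChain s u (s :: t :: l) ↔ s ⋖ t ∧ IsSaturatedChain t u (t :: l) := by
  simp [IsSaturatedChain, List.isChain_cons_cons, and_assoc]

theorem IsSaturatedChain.le : ∀ {l : List P} {s : P}, IsSaturatedChain s u (s :: l) → s ≤ u
  | [], _, h => (by simpa using h.2.2 : _ = u).le
  | _ :: _, _, h =>
    have h := isSaturatedChain_cons_cons.mp h
    h.1.le.trans h.2.le

theorem IsSaturatedChain.exists_eq_cons_cons (h : IsSaturatedChain s u l) (hsu : s < u) :
    ∃ t r, l = s :: t :: r ∧ s ⋖ t ∧ IsSaturatedChain t u (t :: r) := by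
  match l, h.2.1 with
  | [_], rfl => exact absurd (by simpa using h.2.2) hsu.ne
  | _ :: t :: r, rfl => exact ⟨t, r, rfl, isSaturatedChain_cons_cons.mp h⟩

end SaturatedChains

section FirstSteps

variable {P : Type u} [PartialOrder P] {Λ : Type v} [LinearOrder Λ] {lab : P → P → Λ}

/-- `φ s u` is the first element above `s` on a maximal chain of `[s, u]`, chosen in such a way that
moving the start down along `s ⋖ t` prolongs the chosen chain of `[t, u]` exactly when this creates
no descent of the labels. -/
structure IsFirstStepMap (lab : P → P → Λ) (φ : P → P → P) : Prop where
  covBy : ∀ ⦃s u⦄, s < u → s ⋖ φ s u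
  le : ∀ ⦃s u⦄, s < u → φ s u ≤ u
  eq_iff : ∀ ⦃s t u⦄, s ⋖ t → t < u → (φ s u = t ↔ lab s t ≤ lab t (φ t u))

theorem IsFirstStepMap.eq_of_covBy {φ : P → P → P} (hφ : IsFirstStepMap lab φ) {s t : P}
    (h : s ⋖ t) : φ s t = t :=
  (h.eq_or_eq (hφ.covBy h.lt).le (hφ.le h.lt)).resolve_left (hφ.covBy h.lt).ne'

theorem IsELLabeling.exists_isFirstStepMap (hEL : IsELLabeling lab) :
    ∃ φ : P → P → P, IsFirstStepMap lab φ := by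
  have hchain : ∀ s u : P, ∃ x r, s < u → s ⋖ x ∧ IsSaturatedChain x u (x :: r) ∧
      (chainLabels lab (s :: x :: r)).IsChain (· ≤ ·) ∧
      ∀ l, IsSaturatedChain s u l → (chainLabels lab l).IsChain (· ≤ ·) → l = s :: x :: r := by
    intro s u
    by_cases hsu : s < u
    · obtain ⟨l, hl, hinc, huniq, -⟩ := hEL s u hsu.le
      obtain ⟨x, r, rfl, hsx, hx⟩ := hl.exists_eq_cons_cons hsu
      exact ⟨x, r, fun _ => ⟨hsx, hx, hinc, huniq⟩⟩
    · exact ⟨s, [], fun h => absurd h hsu⟩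
  choose φ r hφ using hchain
  refine ⟨φ, fun s u hsu => (hφ s u hsu).1, fun s u hsu => (hφ s u hsu).2.1.le, ?_⟩
  intro s t u hst htu
  obtain ⟨-, hsat, hinc, huniq⟩ := hφ s u (hst.lt.trans htu)
  obtain ⟨htφ, hsat', hinc', huniq'⟩ := hφ t u htu
  constructor
  · intro hx
    rw [hx] at hsat hinc
    have hr : t :: r s u = t :: φ t u :: r t u := huniq' _ hsat hinc.tail
    rw [hr] at hinc
    exact (List.isChain_cons_cons.mp hinc).1
  · intro hle
    have hr : s :: t :: φ t u :: r t u = s :: φ s u :: r s u :=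
      huniq _ (isSaturatedChain_cons_cons.mpr ⟨hst, isSaturatedChain_cons_cons.mpr ⟨htφ, hsat'⟩⟩)
        (List.isChain_cons_cons.mpr ⟨hle, hinc'⟩)
    simp only [List.cons.injEq] at hr
    exact hr.2.1.symm

theorem cons_le_cons_iff {a b : Λ} {l l' : List Λ} :
    a :: l ≤ b :: l' ↔ a < b ∨ a = b ∧ l ≤ l' := by
  simp only [le_iff_lt_or_eq, List.cons_lt_cons_iff, List.cons.injEq]
  tauto

theorem IsELLabeling.le_of_minimal (hEL : IsELLabeling lab) {s t u : P}
    (hst : s ⋖ t) (hmin : ∀ t', s ⋖ t' → lab s t ≤ lab s t') (htu : t ⋖ u) :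
    lab s t ≤ lab t u := by
  have hsu : s < u := hst.lt.trans htu.lt
  obtain ⟨l, hl, hinc, -, hlex⟩ := hEL s u hsu.le
  obtain ⟨x, r, rfl, hsx, hx⟩ := hl.exists_eq_cons_cons hsu
  have hxu : x < u := hx.le.lt_of_ne (by rintro rfl; exact hsx.2 hst.lt htu.lt)
  obtain ⟨y, r', hr, -⟩ := hx.exists_eq_cons_cons hxu
  obtain rfl : r = y :: r' := (List.cons.inj hr).2
  have hxy : lab s x ≤ lab x y := (List.isChain_cons_cons.mp hinc).1
  have hword : chainLabels lab (s :: x :: y :: r') ≤ [lab s t, lab t u] :=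
    hlex [s, t, u] ⟨by simp [hst, htu], rfl, rfl⟩
  simp only [chainLabels, cons_le_cons_iff] at hword
  rcases hword with hlt | ⟨heq, hlt | ⟨heq', -⟩⟩
  · exact absurd (hmin x hsx) hlt.not_ge
  · exact heq ▸ hxy.trans hlt.le
  · exact heq ▸ hxy.trans heq'.le

end FirstSteps

section DescentRecursion

/-- An EL-labeling witnessing that a graded poset is UMEL-shellable. -/
structure IsUMELLabeling {P : Type u} {Λ : Type v} [PartialOrder P] [Fintype P] [LinearOrder Λ]
    (lab : P → P → Λ) : Prop where
  isGraded : IsGraded P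
  isELLabeling : IsELLabeling lab
  isRankUniform : IsRankUniform lab
  isMonotonic : IsMonotonic lab

/-- The values `g s t` and `e s t` on the cover relations of `P` are obtained from their values `g₀`
and `e₀` at the coatoms by summing along maximal chains, a step without a descent having weight `κ`
and one with a descent having weight `κ * v`. Either `e` forbids a descent right after the first
step, or it coincides with `g`. -/
structure IsDescentRecursion {P : Type u} {Λ : Type v} [PartialOrder P] [OrderTop P] [Fintype P]
    [LinearOrder Λ] {K : Type*} [CommSemiring K] (lab : P → P → Λ) (κ v g₀ e₀ : K)
    (g e : P → P → K) : Prop where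
  fst_top : ∀ ⦃s⦄, s ⋖ ⊤ → g s ⊤ = g₀
  snd_top : ∀ ⦃s⦄, s ⋖ ⊤ → e s ⊤ = e₀
  fst_eq : ∀ ⦃s t⦄, s ⋖ t → t ≠ ⊤ → g s t = κ * (ascSum lab g s t + v * desSum lab e s t)
  snd_eq : (∀ ⦃s t⦄, s ⋖ t → t ≠ ⊤ → e s t = κ * ascSum lab g s t) ∨ e = g

namespace IsDescentRecursion

variable {P : Type u} [PartialOrder P] [OrderTop P] [Fintype P] {Λ : Type v} [LinearOrder Λ]
  {lab : P → P → Λ}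

section RankUniform

variable {K : Type*} [CommSemiring K] {κ v g₀ e₀ : K} {g e : P → P → K}

theorem eq_of_rk_eq (h : IsDescentRecursion lab κ v g₀ e₀ g e) (hG : IsGraded P)
    (hU : IsRankUniform lab) {s t s' t' : P} (hr : rk s = rk s') (hst : s ⋖ t) (hst' : s' ⋖ t')
    (hi : ind lab s t = ind lab s' t') : g s t = g s' t' ∧ e s t = e s' t' := by
  induction t using WellFoundedGT.induction generalizing s s' t' with
  | ind t ih =>
    have hrt : rk t = rk t' := by rw [hG s t hst, hG s' t' hst', hr]
    by_cases ht : t = ⊤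
    · subst ht
      obtain rfl := eq_top_of_rk_eq hrt.symm
      exact ⟨(h.fst_top hst).trans (h.fst_top hst').symm,
        (h.snd_top hst).trans (h.snd_top hst').symm⟩
    have ht' : t' ≠ ⊤ := by
      rintro rfl
      exact ht (eq_top_of_rk_eq hrt)
    have hd : desCount lab s t = desCount lab s' t' := hU.2 s t s' t' hr hst hst' hi
    have hasc : ascSum lab g s t = ascSum lab g s' t' := by
      rw [ascSum_eq_sum_desCount_lt_ind, ascSum_eq_sum_desCount_lt_ind, hd]
      exact hU.sum_coversAbove_eq hrt (desCount lab s' t' < ·) fun u u' hu hu' hi' =>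
        (ih u hu.lt hrt hu hu' hi').1
    have hdes : desSum lab e s t = desSum lab e s' t' := by
      rw [desSum_eq_sum_ind_le_desCount, desSum_eq_sum_ind_le_desCount, hd]
      exact hU.sum_coversAbove_eq hrt (· ≤ desCount lab s' t') fun u u' hu hu' hi' =>
        (ih u hu.lt hrt hu hu' hi').2
    have hg : g s t = g s' t' := by rw [h.fst_eq hst ht, h.fst_eq hst' ht', hasc, hdes]
    refine ⟨hg, ?_⟩
    rcases h.snd_eq with he | rfl
    · rw [he hst ht, he hst' ht', hasc]
    · exact hg

theorem ascSum_eq (h : IsDescentRecursion lab κ v g₀ e₀ g e) (hG : IsGraded P)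
    (hU : IsRankUniform lab) {s t t' : P} (hst : s ⋖ t) (hst' : s ⋖ t') :
    ascSum lab g s t = ∑ u ∈ coversAbove t' with desCount lab s t < ind lab t' u, g t' u := by
  have hr : rk t = rk t' := by rw [hG s t hst, hG s t' hst']
  rw [ascSum_eq_sum_desCount_lt_ind]
  exact hU.sum_coversAbove_eq hr (desCount lab s t < ·) fun u u' hu hu' hi =>
    (h.eq_of_rk_eq hG hU hr hu hu' hi).1

theorem desSum_eq (h : IsDescentRecursion lab κ v g₀ e₀ g e) (hG : IsGraded P)
    (hU : IsRankUniform lab) {s t t' : P} (hst : s ⋖ t) (hst' : s ⋖ t') :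
    desSum lab e s t = ∑ u ∈ coversAbove t' with ind lab t' u ≤ desCount lab s t, e t' u := by
  have hr : rk t = rk t' := by rw [hG s t hst, hG s t' hst']
  rw [desSum_eq_sum_ind_le_desCount]
  exact hU.sum_coversAbove_eq hr (· ≤ desCount lab s t) fun u u' hu hu' hi =>
    (h.eq_of_rk_eq hG hU hr hu hu' hi).2

end RankUniform

variable {κ v g₀ e₀ : ℂ} {g e : P → P → ℂ}

theorem isInterlacingPair_of_covBy (h : IsDescentRecursion lab κ v g₀ e₀ g e) (hG : IsGraded P)
    (hU : IsRankUniform lab) (hM : IsMonotonic lab) {s t : P} (hs : ¬ s ⋖ ⊤) (hst : s ⋖ t)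
    (ht : IsInterlacingPair v (coversAbove t) (ind lab t) (g t) (e t)) :
    IsInterlacingPair v (coversAbove s) (ind lab s) (g s) (e s) := by
  set G : ℕ → ℂ := fun d => ∑ u ∈ coversAbove t with d < ind lab t u, g t u
  set E : ℕ → ℂ := fun d => ∑ u ∈ coversAbove t with ind lab t u ≤ d, e t u
  have hg : ∀ x ∈ coversAbove s,
      g s x = κ * (G (desCount lab s x) + v * E (desCount lab s x)) := fun x hx => by
    rw [mem_coversAbove] at hx
    rw [h.fst_eq hx (by rintro rfl; exact hs hx), h.ascSum_eq hG hU hx hst,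
      h.desSum_eq hG hU hx hst]
  have hd : ∀ x ∈ coversAbove s, ∀ y ∈ coversAbove s, ind lab s x ≤ ind lab s y →
      desCount lab s x ≤ desCount lab s y := fun x hx y hy =>
    hM s x y (mem_coversAbove.mp hx) (mem_coversAbove.mp hy)
  have hgg : ∀ x ∈ coversAbove s, ∀ y ∈ coversAbove s, ind lab s x ≤ ind lab s y →
      Interlaces v (g s x) (g s y) := fun x hx y hy hxy => by
    rw [hg x hx, hg y hy]
    exact (ht.sum_fst_add_mul_sum_snd (hd x hx y hy hxy)).mul_mul κ
  rcases h.snd_eq with he | rfl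
  · have he' : ∀ x ∈ coversAbove s, e s x = κ * G (desCount lab s x) := fun x hx => by
      rw [mem_coversAbove] at hx
      rw [he hx (by rintro rfl; exact hs hx), h.ascSum_eq hG hU hx hst]
    refine ⟨hgg, fun x hx y hy hxy => ?_, fun x hx y hy => ?_⟩
    · rw [he' x hx, he' y hy]
      exact (ht.sum_fst (hd x hx y hy hxy)).mul_mul κ
    · rw [he' x hx, he' y hy, hg y hy, ← mul_sub, add_sub_cancel_left]
      exact (ht.sum_snd_sum_fst _ _).mul_flip.mul_mul κ
  · exact ⟨hgg, hgg, fun x _ y _ => by rw [sub_self]; exact .zero_right v _⟩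

theorem isInterlacingPair (h : IsDescentRecursion lab κ v g₀ e₀ g e) (hG : IsGraded P)
    (hU : IsRankUniform lab) (hM : IsMonotonic lab) (h₀ : Interlaces v e₀ (g₀ - e₀)) (s : P) :
    IsInterlacingPair v (coversAbove s) (ind lab s) (g s) (e s) := by
  induction s using WellFoundedGT.induction with
  | ind s ih =>
    by_cases hs : s ⋖ ⊤
    · have htop : ∀ t ∈ coversAbove s, t = ⊤ := fun t ht =>
        (hs.eq_or_eq (mem_coversAbove.mp ht).le le_top).resolve_left (mem_coversAbove.mp ht).ne'
      refine ⟨?_, ?_, ?_⟩ <;> intro t ht t' ht' <;> rw [htop t ht, htop t' ht']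
      · exact fun _ => .refl v _
      · exact fun _ => .refl v _
      · rwa [h.fst_top hs, h.snd_top hs]
    rcases (coversAbove s).eq_empty_or_nonempty with hempty | ⟨t, ht⟩
    · constructor <;> simp [hempty]
    rw [mem_coversAbove] at ht
    exact h.isInterlacingPair_of_covBy hG hU hM hs ht (ih t ht.lt)

theorem sum_ne_zero (h : IsDescentRecursion lab κ v g₀ e₀ g e) (hlab : IsUMELLabeling lab)
    (h₀ : Interlaces v e₀ (g₀ - e₀)) (hv : v ∈ Complex.slitPlane) (hκ : κ ≠ 0) (hg₀ : g₀ ≠ 0)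
    {s : P} (hs : s ≠ ⊤) : ∑ t ∈ coversAbove s, g s t ≠ 0 := by
  induction s using WellFoundedGT.induction with
  | ind s ih =>
    obtain ⟨t, ht, hmin⟩ := (coversAbove s).exists_min_image (lab s)
      ((exists_covBy_of_ne_top hs).imp fun _ => mem_coversAbove.mpr)
    have hst : s ⋖ t := mem_coversAbove.mp ht
    have hpair := h.isInterlacingPair hlab.isGraded hlab.isRankUniform hlab.isMonotonic h₀ s
    refine Interlaces.sum_ne_zero hv ht ?_ fun x hx => hpair.fst t ht x hx (ind_le_ind (hmin x hx))
    by_cases htop : t = ⊤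
    · subst htop
      rwa [h.fst_top hst]
    have hasc : ∀ u ∈ coversAbove t, lab s t ≤ lab t u := fun u hu =>
      hlab.isELLabeling.le_of_minimal hst (fun x hx => hmin x (mem_coversAbove.mpr hx))
        (mem_coversAbove.mp hu)
    rw [h.fst_eq hst htop, ascSum, desSum, Finset.filter_true_of_mem hasc,
      Finset.filter_false_of_mem fun u hu => (hasc u hu).not_gt, Finset.sum_empty, mul_zero,
      add_zero]
    exact mul_ne_zero hκ (ih t hst.lt htop)

end IsDescentRecursion

end DescentRecursion

section StepSums

variable {P : Type u} [PartialOrder P] [LocallyFiniteOrderTop P] [DecidableEq P]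
  {M : Type*} [AddCommMonoid M] {Λ : Type v} [LinearOrder Λ] {lab : P → P → Λ} {φ : P → P → P}

/-- The sum of `F` over the elements `u > s` whose chosen chain from `s` starts with `t`. -/
def stepSum (φ : P → P → P) (F : P → M) (s t : P) : M :=
  ∑ u ∈ Finset.Ioi s with φ s u = t, F u

theorem IsFirstStepMap.filter_Ioi_eq_insert (hφ : IsFirstStepMap lab φ) {s t : P} (hst : s ⋖ t) :
    {u ∈ Finset.Ioi s | φ s u = t} =
      insert t {u ∈ Finset.Ioi t | lab s t ≤ lab t (φ t u)} := by
  ext u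
  simp only [Finset.mem_filter, Finset.mem_Ioi, Finset.mem_insert]
  constructor
  · rintro ⟨hsu, rfl⟩
    rcases (hφ.le hsu).eq_or_lt with h | h
    · exact Or.inl h.symm
    · exact Or.inr ⟨h, (hφ.eq_iff hst h).mp rfl⟩
  · rintro (rfl | ⟨htu, hle⟩)
    · exact ⟨hst.lt, hφ.eq_of_covBy hst⟩
    · exact ⟨hst.lt.trans htu, (hφ.eq_iff hst htu).mpr hle⟩

variable [Fintype P]

theorem IsFirstStepMap.sum_stepSum (hφ : IsFirstStepMap lab φ) (F : P → M) (s : P) :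
    ∑ t ∈ coversAbove s, stepSum φ F s t = ∑ u ∈ Finset.Ioi s, F u :=
  Finset.sum_fiberwise_of_maps_to
    (fun _ hu => mem_coversAbove.mpr (hφ.covBy (Finset.mem_Ioi.mp hu))) F

theorem IsFirstStepMap.stepSum_eq (hφ : IsFirstStepMap lab φ) (F : P → M) {s t : P}
    (hst : s ⋖ t) : stepSum φ F s t = F t + ascSum lab (stepSum φ F) s t := by
  have hmaps : ∀ u ∈ Finset.Ioi t, φ t u ∈ coversAbove t := fun u hu =>
    mem_coversAbove.mpr (hφ.covBy (Finset.mem_Ioi.mp hu))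
  rw [stepSum, hφ.filter_Ioi_eq_insert hst, Finset.sum_insert (by simp), ascSum,
    Finset.sum_filter, Finset.sum_filter, ← Finset.sum_fiberwise_of_maps_to hmaps]
  congr 1
  refine Finset.sum_congr rfl fun x _ => ?_
  rw [stepSum, Finset.sum_congr rfl fun u hu => by rw [(Finset.mem_filter.mp hu).2]]
  split_ifs
  · rfl
  · exact Finset.sum_const_zero

end StepSums

section ChowRecursion

variable {P : Type*} [PartialOrder P] [LocallyFiniteOrder P]

theorem sum_Icc_top_comm [OrderTop P] {M : Type*} [AddCommMonoid M] (f : P → P → M) (s : P) :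
    ∑ w ∈ Finset.Icc s ⊤, ∑ u ∈ Finset.Icc w ⊤, f w u =
      ∑ u ∈ Finset.Icc s ⊤, ∑ w ∈ Finset.Icc s u, f w u :=
  Finset.sum_comm' fun w u => by
    simp only [Finset.mem_Icc, le_top, and_true]
    exact ⟨fun h => ⟨h, h.1.trans h.2⟩, And.left⟩

variable [DecidableEq P]

theorem sum_sum_mu_smul [OrderTop P] {M : Type*} [AddCommGroup M] (f : P → M) (s : P) :
    ∑ w ∈ Finset.Icc s ⊤, ∑ u ∈ Finset.Icc w ⊤, IncidenceAlgebra.mu ℤ w u • f u = f s := by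
  rw [sum_Icc_top_comm]
  simp [← Finset.sum_smul, IncidenceAlgebra.sum_Icc_mu_left]

theorem charPoly_self (s : P) : charPoly s s = 1 := by simp [charPoly]

theorem X_sub_one_mul_redCharPoly {s t : P} (h : s ≠ t) :
    (X - 1) * redCharPoly s t = charPoly s t := by
  have hroot : (charPoly s t).IsRoot 1 := by
    simp [charPoly, eval_finsetSum, IncidenceAlgebra.sum_Icc_mu_right, h]
  simpa only [redCharPoly, C_1] using mul_divByMonic_eq_iff_isRoot.mpr hroot

variable [OrderTop P]

theorem chowAbove_top : chowAbove (⊤ : P) = 1 := by rw [chowAbove_eq, if_pos rfl]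

theorem sum_charPoly_mul_chowAbove (s : P) :
    ∑ u ∈ Finset.Icc s ⊤, charPoly s u * chowAbove u =
      X * chowAbove s + if s = ⊤ then 1 - X else 0 := by
  rw [← Finset.Ioc_insert_left le_top, Finset.sum_insert (by simp), charPoly_self]
  split_ifs with hs
  · simp [hs, chowAbove_top]
  · have hIoc : ∑ u ∈ Finset.Ioc s ⊤, charPoly s u * chowAbove u = (X - 1) * chowAbove s := by
      rw [chowAbove_eq s, if_neg hs, Finset.mul_sum]
      refine Finset.sum_congr rfl fun u hu => ?_
      rw [← X_sub_one_mul_redCharPoly (Finset.mem_Ioc.mp hu).1.ne, mul_assoc]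
    rw [hIoc]
    ring

theorem sum_mu_smul_sum_X_pow_mul_chowAbove (s : P) :
    ∑ w ∈ Finset.Icc s ⊤,
        IncidenceAlgebra.mu ℤ s w • ∑ u ∈ Finset.Icc w ⊤, X ^ (rk u - rk w) * chowAbove u =
      ∑ u ∈ Finset.Icc s ⊤, charPoly s u * chowAbove u := by
  simp only [Finset.smul_sum]
  rw [sum_Icc_top_comm]
  simp only [charPoly, Finset.sum_mul]
  simp [mul_assoc, zsmul_eq_mul]

theorem sum_X_sub_X_pow_mul_chowAbove (s : P) :
    ∑ u ∈ Finset.Icc s ⊤, (X - X ^ (rk u - rk s)) * chowAbove u = X - 1 := by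
  have hmoebius := sum_sum_mu_smul
    (fun w => ∑ u ∈ Finset.Icc w ⊤, X ^ (rk u - rk w) * chowAbove u) s
  simp only [sum_mu_smul_sum_X_pow_mul_chowAbove, sum_charPoly_mul_chowAbove,
    Finset.sum_add_distrib, Finset.sum_ite_eq', Finset.mem_Icc, le_top, and_self, if_true,
    ← Finset.mul_sum] at hmoebius
  simp only [sub_mul, Finset.sum_sub_distrib, ← Finset.mul_sum]
  linear_combination hmoebius

end ChowRecursion

section Duality

variable {P : Type*} [PartialOrder P] {R : Type*}

theorem exists_forall_eq_add_sum_Ioi [LocallyFiniteOrderTop P] [WellFoundedGT P] [Semiring R]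
    (p : P → P → R) (b : P → R) :
    ∃ A : P → R, ∀ s, A s = b s + ∑ u ∈ Finset.Ioi s, p s u * A u := by
  refine ⟨wellFounded_gt.fix fun s A =>
    b s + ∑ u ∈ (Finset.Ioi s).attach, p s u * A u (Finset.mem_Ioi.mp u.2), fun s => ?_⟩
  rw [WellFounded.fix_eq]
  exact congrArg (b s + ·) (Finset.sum_attach (Finset.Ioi s) fun u => p s u * _)

theorem sum_mul_eq_sum_mul_of_recursions [Fintype P] [LocallyFiniteOrderTop P]
    [LocallyFiniteOrderBot P] [Ring R] {p : P → P → R} {a b A H : P → R}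
    (hA : ∀ s, A s = b s + ∑ u ∈ Finset.Ioi s, p s u * A u)
    (hH : ∀ t, H t = a t + ∑ u ∈ Finset.Iio t, H u * p u t) :
    ∑ t, a t * A t = ∑ s, H s * b s := by
  have hright : ∑ s, H s * A s = ∑ s, H s * b s + ∑ s, ∑ t ∈ Finset.Ioi s, H s * p s t * A t := by
    rw [← Finset.sum_add_distrib]
    refine Finset.sum_congr rfl fun s _ => ?_
    conv_lhs => rw [hA s]
    simp only [mul_add, Finset.mul_sum, mul_assoc]
  have hleft : ∑ t, H t * A t = ∑ t, a t * A t + ∑ t, ∑ s ∈ Finset.Iio t, H s * p s t * A t := by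
    rw [← Finset.sum_add_distrib]
    refine Finset.sum_congr rfl fun t _ => ?_
    conv_lhs => rw [hH t]
    simp only [add_mul, Finset.sum_mul]
  have hcomm : ∑ t, ∑ s ∈ Finset.Iio t, H s * p s t * A t =
      ∑ s, ∑ t ∈ Finset.Ioi s, H s * p s t * A t :=
    Finset.sum_comm' fun t s => by simp
  exact add_right_cancel (hcomm ▸ hleft.symm.trans hright)

end Duality

section DualChow

variable {P : Type u} [PartialOrder P] {K : Type*} [Field K] {z : K} {c : K} {A : P → K}

/-- The coefficients of the recursion for the Chow polynomials of the intervals `[⊥, t]` of the dual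
poset, evaluated at `z`: they are free of Möbius functions. -/
noncomputable def chowKernel (z : K) (s t : P) : K :=
  (z ^ (rk t - rk s) - z) / (z - 1)

theorem IsGraded.chowKernel_eq_zero (hG : IsGraded P) (z : K) {s t : P} (h : s ⋖ t) :
    chowKernel z s t = 0 := by
  simp [chowKernel, hG s t h]

theorem IsGraded.chowKernel_eq_mul_add_one [Finite P] (hG : IsGraded P) (hz : z ≠ 1) {s t u : P}
    (hst : s ⋖ t) (htu : t < u) : chowKernel z s u = z * (chowKernel z t u + 1) := by
  have hz' : z - 1 ≠ 0 := sub_ne_zero.mpr hz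
  have hrk : rk u - rk s = rk u - rk t + 1 := by
    have := rk_strictMono htu
    have := hG s t hst
    omega
  rw [chowKernel, chowKernel, hrk]
  field_simp
  ring

/-- The sum over `P` of the weights `A` is the Chow polynomial of the dual of `P` at `z` if `c = 0`,
and its augmented Chow polynomial at `z` if `c = 1`. -/
def IsChowWeight [OrderTop P] [LocallyFiniteOrderTop P] [DecidableEq P] (z c : K) (A : P → K) :
    Prop :=
  ∀ s, A s = (if s = ⊤ then 1 else c * z ^ (rk (⊤ : P) - rk s)) +
    ∑ u ∈ Finset.Ioi s, chowKernel z s u * A u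

theorem exists_isChowWeight [OrderTop P] [LocallyFiniteOrderTop P] [WellFoundedGT P]
    [DecidableEq P] (z c : K) : ∃ A : P → K, IsChowWeight z c A :=
  exists_forall_eq_add_sum_Ioi _ _

variable [BoundedOrder P] [LocallyFiniteOrder P] [DecidableEq P]

theorem IsGraded.aeval_chowAbove_dual [Finite P] (hG : IsGraded P) (hz : z ≠ 1) (t : P) :
    aeval z (chowAbove (OrderDual.toDual t)) =
      1 + ∑ u ∈ Finset.Iio t, aeval z (chowAbove (OrderDual.toDual u)) * chowKernel z u t := by
  have hz' : z - 1 ≠ 0 := sub_ne_zero.mpr hz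
  have hdual : ∑ u ∈ Finset.Iic t,
      (z - z ^ (rk t - rk u)) * aeval z (chowAbove (OrderDual.toDual u)) = z - 1 := by
    have h := congrArg (aeval z) (sum_X_sub_X_pow_mul_chowAbove (OrderDual.toDual t))
    simp only [map_sum, map_mul, map_sub, map_pow, aeval_X, map_one] at h
    rw [← h]
    refine Finset.sum_equiv OrderDual.toDual (fun u => by simp) fun u hu => ?_
    have := hG.rk_toDual_add_rk u
    have := hG.rk_toDual_add_rk t
    have := rk_strictMono.monotone (Finset.mem_Iic.mp hu)
    rw [show rk (OrderDual.toDual u) - rk (OrderDual.toDual t) = rk t - rk u by omega]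
  rw [← Finset.Iio_insert, Finset.sum_insert (by simp), Nat.sub_self, pow_zero] at hdual
  have hkernel : ∀ u ∈ Finset.Iio t,
      (z - z ^ (rk t - rk u)) * aeval z (chowAbove (OrderDual.toDual u)) =
        -(z - 1) * (aeval z (chowAbove (OrderDual.toDual u)) * chowKernel z u t) := fun u _ => by
    rw [chowKernel]
    field_simp
    ring
  rw [Finset.sum_congr rfl hkernel, ← Finset.mul_sum] at hdual
  apply mul_left_cancel₀ hz'
  linear_combination hdual

variable [Fintype P]

theorem IsGraded.aeval_chowPoly_dual (hG : IsGraded P) (hz : z ≠ 1) (hA : IsChowWeight z 0 A) :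
    aeval z (chowPoly Pᵒᵈ) = ∑ s, A s := by
  have h := sum_mul_eq_sum_mul_of_recursions hA (hG.aeval_chowAbove_dual hz)
  simpa [chowPoly] using h.symm

theorem IsGraded.aeval_augChowPoly_dual (hG : IsGraded P) (hz : z ≠ 1) (hA : IsChowWeight z 1 A) :
    aeval z (augChowPoly Pᵒᵈ) = ∑ s, A s := by
  have h := sum_mul_eq_sum_mul_of_recursions hA (hG.aeval_chowAbove_dual hz)
  simp only [one_mul] at h
  rw [h, augChowPoly, map_sum]
  symm
  refine Finset.sum_equiv OrderDual.toDual (fun s => by simp) fun s _ => ?_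
  have := hG.rk_toDual_add_rk s
  rw [map_mul, map_pow, aeval_X, mul_comm,
    show rk (OrderDual.toDual s) = rk (⊤ : P) - rk s by omega]
  split_ifs with hs
  · simp [hs]
  · rfl

end DualChow

section ChowSums

variable {P : Type u} [PartialOrder P] [OrderTop P] [DecidableEq P] {K : Type*} [Field K]
  {z c : K} {A : P → K}

/-- The contribution of `u` to the recursion for a weight `A` at `s < u`. -/
noncomputable def chowTerm (z c : K) (A : P → K) (s u : P) : K :=
  chowKernel z s u * A u + if u = ⊤ then c * z ^ (rk u - rk s) else 0

theorem chowTerm_of_covBy (hG : IsGraded P) {s t : P} (h : s ⋖ t) :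
    chowTerm z c A s t = if t = ⊤ then c * z else 0 := by
  simp [chowTerm, hG.chowKernel_eq_zero z h, hG s t h]

theorem chowTerm_eq_mul_add [Finite P] (hG : IsGraded P) (hz : z ≠ 1) {s t u : P} (hst : s ⋖ t)
    (htu : t < u) : chowTerm z c A s u = z * (chowTerm z c A t u + A u) := by
  have hrk : rk u - rk s = rk u - rk t + 1 := by
    have := rk_strictMono htu
    have := hG s t hst
    omega
  simp only [chowTerm]
  rw [hG.chowKernel_eq_mul_add_one hz hst htu, hrk]
  split_ifs <;> ring

variable [LocallyFiniteOrderTop P]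

theorem IsChowWeight.apply_top (hA : IsChowWeight z c A) : A ⊤ = 1 := by
  simpa using hA ⊤

theorem IsChowWeight.eq_sum_chowTerm (hA : IsChowWeight z c A) {s : P} (hs : s ≠ ⊤) :
    A s = ∑ u ∈ Finset.Ioi s, chowTerm z c A s u := by
  have htop : (⊤ : P) ∈ Finset.Ioi s := Finset.mem_Ioi.mpr (lt_top_iff_ne_top.mpr hs)
  simp only [chowTerm, Finset.sum_add_distrib]
  rw [Finset.sum_ite_eq', if_pos htop, hA s, if_neg hs, add_comm]

/-- The part of the recursion for a weight `A` at `s` coming from the elements `u` whose chosen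
chain from `s` starts with `t`. -/
noncomputable def chowStepSum (φ : P → P → P) (z c : K) (A : P → K) (s t : P) : K :=
  stepSum φ (chowTerm z c A s) s t

variable [Fintype P] {Λ : Type v} [LinearOrder Λ] {lab : P → P → Λ} {φ : P → P → P}

theorem chowStepSum_eq (hφ : IsFirstStepMap lab φ) (hG : IsGraded P) (hz : z ≠ 1) {s t : P}
    (hst : s ⋖ t) :
    chowStepSum φ z c A s t = (if t = ⊤ then c * z else 0) +
      z * ascSum lab (chowStepSum φ z c A + stepSum φ A) s t := by
  rw [chowStepSum, hφ.stepSum_eq _ hst, chowTerm_of_covBy hG hst, ascSum, ascSum, Finset.mul_sum]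
  congr 1
  refine Finset.sum_congr rfl fun x _ => ?_
  rw [Pi.add_apply, Pi.add_apply, chowStepSum, stepSum, stepSum, stepSum,
    ← Finset.sum_add_distrib, Finset.mul_sum]
  refine Finset.sum_congr rfl fun u hu => ?_
  exact chowTerm_eq_mul_add hG hz hst (Finset.mem_Ioi.mp (Finset.mem_filter.mp hu).1)

theorem IsChowWeight.eq_sum_chowStepSum (hA : IsChowWeight z c A) (hφ : IsFirstStepMap lab φ)
    {s : P} (hs : s ≠ ⊤) : A s = ∑ t ∈ coversAbove s, chowStepSum φ z c A s t := by
  simp only [chowStepSum]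
  rw [hφ.sum_stepSum, ← hA.eq_sum_chowTerm hs]

theorem IsChowWeight.isDescentRecursion (hA : IsChowWeight z c A) (hφ : IsFirstStepMap lab φ)
    (hG : IsGraded P) (hz₀ : z ≠ 0) (hz₁ : z ≠ 1) (hz : 1 + z ≠ 0) :
    IsDescentRecursion lab (1 + z) (z / (1 + z) ^ 2) (1 + z * c) ((1 + z) * c)
      (chowStepSum φ z c A + stepSum φ A) (((1 + z) / z) • chowStepSum φ z c A) where
  fst_top s hs := by
    rw [Pi.add_apply, Pi.add_apply, chowStepSum_eq hφ hG hz₁ hs, hφ.stepSum_eq A hs, ascSum_top,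
      ascSum_top, hA.apply_top, if_pos rfl]
    ring
  snd_top s hs := by
    rw [Pi.smul_apply, Pi.smul_apply, chowStepSum_eq hφ hG hz₁ hs, ascSum_top, if_pos rfl,
      smul_eq_mul]
    field_simp
    ring
  fst_eq s t hst ht := by
    have hsplit : ascSum lab (chowStepSum φ z c A) s t + ascSum lab (stepSum φ A) s t =
        ascSum lab (chowStepSum φ z c A + stepSum φ A) s t := Finset.sum_add_distrib.symm
    have hdes : desSum lab (((1 + z) / z) • chowStepSum φ z c A) s t =
        (1 + z) / z * desSum lab (chowStepSum φ z c A) s t := (Finset.mul_sum _ _ _).symm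
    rw [Pi.add_apply, Pi.add_apply, chowStepSum_eq hφ hG hz₁ hst, if_neg ht,
      hφ.stepSum_eq A hst, hA.eq_sum_chowStepSum hφ ht, ← ascSum_add_desSum lab _ s t, hdes,
      ← hsplit]
    field_simp
    ring
  snd_eq := Or.inl fun s t hst ht => by
    rw [Pi.smul_apply, Pi.smul_apply, chowStepSum_eq hφ hG hz₁ hst, if_neg ht, smul_eq_mul]
    field_simp
    ring

theorem div_one_add_sq_mem_slitPlane {z : ℂ} (hz : z.im ≠ 0) :
    z / (1 + z) ^ 2 ∈ Complex.slitPlane := by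
  by_contra h
  simp only [Complex.mem_slitPlane_iff, not_or, not_lt, not_not] at h
  set r := (z / (1 + z) ^ 2).re
  have hz' : 1 + z ≠ 0 := fun h0 => hz (by simpa using congrArg Complex.im h0)
  have hr : z = r * (1 + z) ^ 2 :=
    (div_eq_iff (pow_ne_zero 2 hz')).mp (Complex.ext rfl (by simpa using h.2))
  have hre : z.re = r * ((1 + z.re) ^ 2 - z.im ^ 2) := by
    simpa [pow_two] using congrArg Complex.re hr
  have him : z.im = r * ((1 + z.re) * z.im + z.im * (1 + z.re)) := by
    simpa [pow_two] using congrArg Complex.im hr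
  have hsum : 1 = 2 * r * (1 + z.re) := mul_right_cancel₀ hz (by linear_combination him)
  have hsub : z.re - 1 = 2 * -r * z.im ^ 2 := by
    linear_combination 2 * hre - (1 + z.re) * hsum
  have hone : 1 ≤ z.re := by nlinarith [mul_nonneg (neg_nonneg.mpr h.1) (sq_nonneg z.im)]
  nlinarith [h.1]

theorem IsChowWeight.sum_Ici_ne_zero {z c : ℂ} {A : P → ℂ} (hA : IsChowWeight z c A)
    (hlab : IsUMELLabeling lab) (hc : c = 0 ∨ c = 1) (hz : z.im ≠ 0) (s : P) :
    ∑ u ∈ Finset.Ici s, A u ≠ 0 := by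
  obtain rfl | hs := eq_or_ne s ⊤
  · rw [← Finset.Ioi_insert, Finset.sum_insert (by simp), Finset.sum_eq_zero (by simp), add_zero,
      hA.apply_top]
    exact one_ne_zero
  have hz₀ : z ≠ 0 := by rintro rfl; exact hz rfl
  have hz₁ : z ≠ 1 := by rintro rfl; exact hz rfl
  have hz₂ : 1 + z ≠ 0 := fun h => hz (by simpa using congrArg Complex.im h)
  obtain ⟨φ, hφ⟩ := hlab.isELLabeling.exists_isFirstStepMap
  have hsum : ∑ u ∈ Finset.Ici s, A u =
      ∑ t ∈ coversAbove s, (chowStepSum φ z c A + stepSum φ A) s t := by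
    rw [← Finset.Ioi_insert, Finset.sum_insert (by simp), hA.eq_sum_chowStepSum hφ hs,
      ← hφ.sum_stepSum, ← Finset.sum_add_distrib]
    rfl
  rw [hsum]
  have hrec := hA.isDescentRecursion hφ hlab.isGraded hz₀ hz₁ hz₂
  refine hrec.sum_ne_zero hlab ?_ (div_one_add_sq_mem_slitPlane hz) hz₂ ?_ hs
  · rcases hc with rfl | rfl
    · rw [mul_zero]
      exact .zero_left _ _
    · rw [mul_one, mul_one, sub_self]
      exact .zero_right _ _
  · rcases hc with rfl | rfl
    · simp
    · rwa [mul_one]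

end ChowSums

section ChainSums

variable {P : Type u} [PartialOrder P] [Fintype P]

theorem mem_orderComplexFaces {c : Finset P} :
    c ∈ orderComplexFaces P ↔ IsChain (· ≤ ·) (c : Set P) := by
  simp [orderComplexFaces]

theorem hPoly_dual (P : Type*) [PartialOrder P] [Fintype P] : hPoly Pᵒᵈ = hPoly P :=
  congrArg hPolyOfFaces <| Finset.ext fun (c : Finset P) =>
    (mem_orderComplexFaces (P := Pᵒᵈ) (c := c)).trans <|
      (⟨IsChain.symm, IsChain.symm⟩ : IsChain (α := Pᵒᵈ) (· ≤ ·) (c : Set P) ↔ _).trans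
        (mem_orderComplexFaces (P := P) (c := c)).symm

open Classical in
/-- The generating function at `q` of the chains contained in `U`, counted by cardinality. -/
noncomputable def chainSum {K : Type*} [CommSemiring K] (q : K) (U : Finset P) : K :=
  ∑ c ∈ orderComplexFaces P with c ⊆ U, q ^ c.card

theorem aeval_hPolyOfFaces {V K : Type*} [Field K] {y : K} (hy : y ≠ 1)
    (F : Finset (Finset V)) :
    aeval y (hPolyOfFaces F) = (1 - y) ^ F.sup Finset.card * ∑ c ∈ F, (y / (1 - y)) ^ c.card := by
  have : 1 - y ≠ 0 := sub_ne_zero.mpr hy.symm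
  have hmaps : ∀ c ∈ F, c.card ∈ Finset.range (F.sup Finset.card + 1) := fun c hc =>
    Finset.mem_range_succ_iff.mpr (Finset.le_sup (f := Finset.card) hc)
  rw [hPolyOfFaces, map_sum, ← Finset.sum_fiberwise_of_maps_to hmaps, Finset.mul_sum]
  refine Finset.sum_congr rfl fun i hi => ?_
  have hpow : (1 - y) ^ F.sup Finset.card = (1 - y) ^ (F.sup Finset.card - i) * (1 - y) ^ i := by
    rw [← pow_add, Nat.sub_add_cancel (Finset.mem_range_succ_iff.mp hi)]
  rw [Finset.sum_congr rfl fun c hc => by rw [(Finset.mem_filter.mp hc).2], Finset.sum_const,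
    nsmul_eq_mul, div_pow, hpow]
  simp only [map_mul, map_pow, map_sub, map_one, aeval_X, map_natCast]
  field_simp

theorem aeval_hPoly {K : Type*} [Field K] {y : K} (hy : y ≠ 1) :
    aeval y (hPoly P) = (1 - y) ^ (orderComplexFaces P).sup Finset.card *
      chainSum (y / (1 - y)) (Finset.univ : Finset P) := by
  simp only [chainSum, Finset.subset_univ, Finset.filter_true]
  exact aeval_hPolyOfFaces hy _

section Recursion

variable [LocallyFiniteOrderTop P] {K : Type*} [CommSemiring K]

open Classical in
theorem sum_isLeast_pow_card (q : K) (s : P) :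
    ∑ c ∈ orderComplexFaces P with IsLeast (↑(c : Finset P) : Set P) s, q ^ c.card =
      q * chainSum q (Finset.Ioi s) := by
  rw [chainSum, Finset.mul_sum]
  have hlt : ∀ c : Finset P, c ⊆ Finset.Ioi s → s ∉ c := fun c hc hs =>
    (Finset.mem_Ioi.mp (hc hs)).false
  refine Finset.sum_nbij' (·.erase s) (insert s) (fun c hc => ?_) (fun c hc => ?_) (fun c hc => ?_)
    (fun c hc => ?_) (fun c hc => ?_) <;>
    simp only [Finset.mem_filter, mem_orderComplexFaces] at hc ⊢
  · refine ⟨hc.1.mono (by simp), fun t ht => ?_⟩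
    rw [Finset.mem_erase] at ht
    exact Finset.mem_Ioi.mpr ((hc.2.2 ht.2).lt_of_ne ht.1.symm)
  · have hle : ∀ t ∈ c, s ≤ t := fun t ht => (Finset.mem_Ioi.mp (hc.2 ht)).le
    rw [Finset.coe_insert]
    exact ⟨hc.1.insert fun t ht _ => Or.inl (hle t ht), Set.mem_insert _ _,
      fun t ht => (Set.mem_insert_iff.mp ht).elim (fun h => h.ge) (hle t)⟩
  · exact Finset.insert_erase hc.2.1
  · exact Finset.erase_insert (hlt c hc.2)
  · rw [← pow_succ', Finset.card_erase_add_one hc.2.1]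

theorem chainSum_eq_one_add (q : K) {U : Finset P} (hU : IsUpperSet (U : Set P)) :
    chainSum q U = 1 + q * ∑ s ∈ U, chainSum q (Finset.Ioi s) := by
  classical
  set S := {c ∈ orderComplexFaces P | c ⊆ U} with hS
  have hempty : ∅ ∈ S := by simp [hS, mem_orderComplexFaces]
  have hleast : ∀ c ∈ S.erase ∅, ∃ s, {t ∈ U | IsLeast (c : Set P) t} = {s} := fun c hc => by
    simp only [hS, Finset.mem_erase, Finset.mem_filter, mem_orderComplexFaces] at hc
    obtain ⟨s, hs⟩ := c.exists_minimal (Finset.nonempty_iff_ne_empty.mpr hc.1)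
    have hsc : IsLeast (c : Set P) s := ⟨hs.1, fun t ht => (hc.2.1.total hs.1 ht).elim id (hs.2 ht)⟩
    refine ⟨s, Finset.ext fun t => ?_⟩
    rw [Finset.mem_filter, Finset.mem_singleton]
    exact ⟨fun ht => ht.2.unique hsc, by rintro rfl; exact ⟨hc.2.2 hs.1, hsc⟩⟩
  calc chainSum q U = ∑ c ∈ S, q ^ c.card := by rw [chainSum]
    _ = 1 + ∑ c ∈ S.erase ∅, q ^ c.card := by
      rw [← Finset.add_sum_erase S _ hempty, Finset.card_empty, pow_zero]
    _ = 1 + ∑ c ∈ S.erase ∅, ∑ s ∈ U with IsLeast (↑(c : Finset P) : Set P) s, q ^ c.card := by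
      congr 1
      refine Finset.sum_congr rfl fun c hc => ?_
      obtain ⟨s, hs⟩ := hleast c hc
      rw [hs, Finset.sum_singleton]
    _ = 1 + ∑ s ∈ U, ∑ c ∈ orderComplexFaces P with IsLeast (↑(c : Finset P) : Set P) s,
        q ^ c.card := by
      congr 1
      refine Finset.sum_comm' fun c s => ?_
      simp only [hS, Finset.mem_erase, Finset.mem_filter]
      constructor
      · tauto
      · rintro ⟨⟨hc, hs⟩, hsU⟩
        exact ⟨⟨(Finset.nonempty_iff_ne_empty.mp ⟨s, hs.1⟩), hc,
          fun t ht => hU (hs.2 ht) hsU⟩, hsU, hs⟩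
    _ = 1 + q * ∑ s ∈ U, chainSum q (Finset.Ioi s) := by
      rw [Finset.mul_sum]
      simp only [sum_isLeast_pow_card]

end Recursion

/-- The chain sums over the elements above `s`, adjusted at `⊤` in such a way that their recursion
becomes homogeneous. -/
noncomputable def chainWeight [OrderTop P] [LocallyFiniteOrderTop P] [DecidableEq P] {K : Type*}
    [Field K] (q : K) (s : P) : K :=
  chainSum q (Finset.Ioi s) + if s = ⊤ then 1 / q else 0

section ChainWeights

variable [OrderTop P] [LocallyFiniteOrderTop P] [DecidableEq P] {K : Type*} [Field K] {q : K}

theorem chainWeight_top (q : K) : chainWeight q (⊤ : P) = 1 + 1 / q := by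
  rw [chainWeight, if_pos rfl, Finset.Ioi_top, chainSum_eq_one_add q (by simp [isUpperSet_empty]),
    Finset.sum_empty, mul_zero, add_zero]

theorem chainSum_eq_mul_sum_chainWeight (hq : q ≠ 0) {U : Finset P} (htop : ⊤ ∈ U)
    (hU : IsUpperSet (U : Set P)) : chainSum q U = q * ∑ u ∈ U, chainWeight q u := by
  simp only [chainWeight]
  rw [chainSum_eq_one_add q hU, Finset.sum_add_distrib, Finset.sum_ite_eq', if_pos htop]
  field_simp
  ring

theorem chainWeight_eq_mul_sum (hq : q ≠ 0) {s : P} (hs : s ≠ ⊤) :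
    chainWeight q s = q * ∑ u ∈ Finset.Ioi s, chainWeight q u := by
  rw [← chainSum_eq_mul_sum_chainWeight hq (by simpa [lt_top_iff_ne_top] using hs)
    (by simpa using isUpperSet_Ioi s), chainWeight, if_neg hs, add_zero]

end ChainWeights

end ChainSums

section RealRooted

variable {P : Type u} [PartialOrder P] [Fintype P] {Λ : Type v} [LinearOrder Λ] {lab : P → P → Λ}

section Recursion

variable [OrderTop P] [LocallyFiniteOrderTop P] {K : Type*} [Field K] {q : K} {A : P → K}

theorem IsFirstStepMap.isDescentRecursion_stepSum [DecidableEq P] {φ : P → P → P}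
    (hφ : IsFirstStepMap lab φ) (hq : 1 + q ≠ 0) (hA : ∀ s ≠ ⊤, A s = q * ∑ u ∈ Finset.Ioi s, A u) :
    IsDescentRecursion lab (1 + q) (q / (1 + q)) (A ⊤) (A ⊤) (stepSum φ A) (stepSum φ A) where
  fst_top s hs := by rw [hφ.stepSum_eq A hs, ascSum_top, add_zero]
  snd_top s hs := by rw [hφ.stepSum_eq A hs, ascSum_top, add_zero]
  fst_eq s t hst ht := by
    rw [hφ.stepSum_eq A hst, hA t ht, ← hφ.sum_stepSum, ← ascSum_add_desSum lab _ s t]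
    field_simp
    ring
  snd_eq := Or.inr rfl

theorem IsUMELLabeling.sum_Ici_ne_zero {q : ℂ} {A : P → ℂ} (hlab : IsUMELLabeling lab)
    (hq : 1 + q ≠ 0) (hv : q / (1 + q) ∈ Complex.slitPlane) (htop : A ⊤ ≠ 0)
    (hA : ∀ s ≠ ⊤, A s = q * ∑ u ∈ Finset.Ioi s, A u) (s : P) : ∑ u ∈ Finset.Ici s, A u ≠ 0 := by
  classical
  rw [← Finset.Ioi_insert, Finset.sum_insert (by simp)]
  obtain rfl | hs := eq_or_ne s ⊤
  · rwa [Finset.sum_eq_zero (by simp), add_zero]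
  obtain ⟨φ, hφ⟩ := hlab.isELLabeling.exists_isFirstStepMap
  rw [hA s hs, ← add_one_mul, add_comm, ← hφ.sum_stepSum]
  refine mul_ne_zero hq ((hφ.isDescentRecursion_stepSum hq hA).sum_ne_zero hlab ?_ hv hq htop hs)
  rw [sub_self]
  exact .zero_right _ _

end Recursion

theorem IsUMELLabeling.realRooted_hPoly [BoundedOrder P] (hlab : IsUMELLabeling lab) :
    RealRooted (hPoly P) := by
  classical
  let _ : LocallyFiniteOrder P := Fintype.toLocallyFiniteOrder
  intro y hroot
  by_contra hy
  have hy₀ : y ≠ 0 := by rintro rfl; exact hy rfl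
  have hy₁ : y ≠ 1 := by rintro rfl; exact hy rfl
  have hsub : 1 - y ≠ 0 := sub_ne_zero.mpr hy₁.symm
  set q := y / (1 - y) with hq
  have hq₀ : q ≠ 0 := div_ne_zero hy₀ hsub
  have hq₁ : 1 + q = 1 / (1 - y) := by rw [hq]; field_simp; ring
  have hq₂ : 1 + q ≠ 0 := hq₁ ▸ one_div_ne_zero hsub
  have hv : q / (1 + q) = y := by rw [hq₁, hq]; field_simp
  have htop : chainWeight q (⊤ : P) ≠ 0 := by
    rw [chainWeight_top, show 1 + 1 / q = (1 + q) / q by field_simp; ring]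
    exact div_ne_zero hq₂ hq₀
  have hne := hlab.sum_Ici_ne_zero hq₂ (hv ▸ Complex.mem_slitPlane_iff.mpr (Or.inr hy)) htop
    (fun s hs => chainWeight_eq_mul_sum hq₀ hs) ⊥
  rw [Finset.Ici_bot] at hne
  rw [aeval_hPoly hy₁, chainSum_eq_mul_sum_chainWeight hq₀ (Finset.mem_univ _)
    (by simpa using isUpperSet_univ)] at hroot
  exact mul_ne_zero (pow_ne_zero _ hsub) (mul_ne_zero hq₀ hne) hroot

variable [BoundedOrder P] [LocallyFiniteOrder P] [DecidableEq P]

theorem IsUMELLabeling.realRooted_chowPoly_dual (hlab : IsUMELLabeling lab) :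
    RealRooted (chowPoly Pᵒᵈ) := by
  intro z hroot
  by_contra hz
  have hz₁ : z ≠ 1 := by rintro rfl; exact hz rfl
  obtain ⟨A, hA⟩ := exists_isChowWeight (P := P) z 0
  have hne := hA.sum_Ici_ne_zero hlab (Or.inl rfl) hz ⊥
  rw [Finset.Ici_bot, ← hlab.isGraded.aeval_chowPoly_dual hz₁ hA] at hne
  exact hne hroot

theorem IsUMELLabeling.realRooted_augChowPoly_dual (hlab : IsUMELLabeling lab) :
    RealRooted (augChowPoly Pᵒᵈ) := by
  intro z hroot
  by_contra hz
  have hz₁ : z ≠ 1 := by rintro rfl; exact hz rfl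
  obtain ⟨A, hA⟩ := exists_isChowWeight (P := P) z 1
  have hne := hA.sum_Ici_ne_zero hlab (Or.inr rfl) hz ⊥
  rw [Finset.Ici_bot, ← hlab.isGraded.aeval_augChowPoly_dual hz₁ hA] at hne
  exact hne hroot

end RealRooted

end UMEL

theorem mainTheorem10 (P : Type u) [PartialOrder P] [BoundedOrder P] [Fintype P]
    [LocallyFiniteOrder P] [DecidableEq P] (hP : UMEL.IsUMELShellable.{u, v} P) :
    UMEL.RealRooted (UMEL.hPoly Pᵒᵈ) ∧
    UMEL.RealRooted (UMEL.chowPoly Pᵒᵈ) ∧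
    UMEL.RealRooted (UMEL.augChowPoly Pᵒᵈ) := by
  obtain ⟨hG, Λ, _, lab, hEL, hU, hM⟩ := hP
  have hlab : UMEL.IsUMELLabeling lab := ⟨hG, hEL, hU, hM⟩
  exact ⟨UMEL.hPoly_dual P ▸ hlab.realRooted_hPoly, hlab.realRooted_chowPoly_dual,
    hlab.realRooted_augChowPoly_dual⟩
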